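/- A *dipole* is a pair $A=(s_A,e_A)$ of distinct points of $\mathbb R^2$; let $\mathbb D$ be the set of dipoles. For a dipole $A$ and a point $p$ exactly one of seven relations $A\,R\,p$ holds: $p$ is to the left of $A$ (l), to the right (r), straight behind $A$ (b), at the start point (s), strictly between start and end point (i), at the end point (e), or straight in front of $A$ (f). Two dipoles $A,B$ are in the relation $r_1r_2r_3r_4r_5$ if $A\,r_1\,s_B$, $A\,r_2\,e_B$, $B\,r_3\,s_A$, $B\,r_4\,e_A$, and $r_5\in\{+,-,P,A\}$ records whether the oriented angle from $A$ to $B$ is positive or negative, or $A$ and $B$ are parallel with the same direction ($P$) or with opposite directions ($A$). The base relations of the calculus $\mathcal{DRA}_{fp}$ are those symbols $b=r_1r_2r_3r_4r_5$ whose extension $R_b\subseteq\mathbb D\times\mathbb D$ is non-empty. For a calculus with base relations $b$ interpreted by non-empty, pairwise disjoint and jointly exhaustive relations $R_b$ on a domain, the (weak) composition is $b_1;b_2=\{b\mid (R_{b_1}\circ R_{b_2})\cap R_b\neq\emptyset\}$, where $R_{b_1}\circ R_{b_2}=\{(x,z)\mid\exists y.\ (x,y)\in R_{b_1},\ (y,z)\in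 R_{b_2}\}$. Composition is *strong* if $\bigcup_{b\in b_1;b_2}R_b=R_{b_1}\circ R_{b_2}$ for all base relations $b_1,b_2$. Let $d_1\sim d_2$ if the dipoles $d_1,d_2$ have the same start point and point in the same direction, let $\mathbb{OP}=\mathbb D/{\sim}$ be the set of oriented points of the plane and $q:\mathbb D\to\mathbb{OP}$ the projection. The calculus $\mathcal{DRA}_{opp}$ over $\mathbb{OP}$ (oriented points with parallelism) is the quotient of $\mathcal{DRA}_{fp}$ by $\sim$: its base relations are the classes of base relations of $\mathcal{DRA}_{fp}$ under the equivalence relation generated by identifying $b_1,b_2$ whenever $(q\times q)(R_{b_1})\cap(q\times q)(R_{b_2})\neq\emptyset$, and a class $c$ is interpreted as $R_c=\bigcup_{b\in c}(q\times q)(R_b)$. **Corollary.** The composition table of $\mathcal{DRA}_{opp}$ is the one induced by the quotient, that is, $c_1;c_2=\{[b]\mid b\in b_1;b_2,\ b_1\in c_1,\ b_2\in c_2\}$ for all base relations $c_1,c_2$ of $\mathcal{DRA}_{opp}$, and composition in $\mathcal{DRA}_{opp}$ is strong. -/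

import Mathlib

open scoped SetRel

namespace DipoleCalculus

/-! ### Qualitative calculi, weak composition, strength, quotients -/

/-- A qualitative calculus over a domain `U`: finitely many (names of) base relations, interpreted
as nonempty, pairwise disjoint and jointly exhaustive binary relations on `U`. -/
structure QualCalculus (U : Type) where
  /-- names of the base relations -/
  Base : Type
  finite_base : Finite Base
  /-- the set-theoretic extension `R_b` of a base relation `b` -/
  rel : Base → SetRel U U
  nonempty_rel : ∀ b, (rel b).Nonempty
  pairwise_disjoint : ∀ b b', b ≠ b' → Disjoint (rel b) (rel b')
  exhaustive : ∀ x y, ∃ b, (x, y) ∈ rel b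

namespace QualCalculus

variable {U : Type}

/-- The extension of a general relation, that is, of a set of base relations. -/
def ext (C : QualCalculus U) (S : Set C.Base) : SetRel U U := ⋃ b ∈ S, C.rel b

/-- Weak composition `b₁ ; b₂ = {b ∣ (R_{b₁} ∘ R_{b₂}) ∩ R_b ≠ ∅}` (`○` is Mathlib's
composition of relations: `(x, z) ∈ R ○ S` iff `(x, y) ∈ R` and `(y, z) ∈ S` for some `y`). -/
def weakComp (C : QualCalculus U) (b₁ b₂ : C.Base) : Set C.Base :=
  {b | ((C.rel b₁ ○ C.rel b₂) ∩ C.rel b).Nonempty}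

/-- Composition is strong if `R_{b₁ ; b₂} = R_{b₁} ∘ R_{b₂}` for all base relations. -/
def IsStrong (C : QualCalculus U) : Prop :=
  ∀ b₁ b₂ : C.Base, C.ext (C.weakComp b₁ b₂) = C.rel b₁ ○ C.rel b₂

/-- The image `P(q × q)(R_b)` of a base relation under the factorization `q : U → U/∼`. -/
def image (C : QualCalculus U) (s : Setoid U) (b : C.Base) :
    SetRel (Quotient s) (Quotient s) :=
  Prod.map (Quotient.mk s) (Quotient.mk s) '' C.rel b

/-- The equivalence relation on base relations generated by identifying `b₁` and `b₂` whenever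
their images in the quotient domain meet. -/
def baseSetoid (C : QualCalculus U) (s : Setoid U) : Setoid C.Base :=
  Relation.EqvGen.setoid fun b₁ b₂ => (C.image s b₁ ∩ C.image s b₂).Nonempty

/-- The quotient of a calculus by an equivalence relation on its domain. The base relations are
the classes of base relations of `C`; a class is interpreted by the union of the images of its
members. -/
def quotient (C : QualCalculus U) (s : Setoid U) : QualCalculus (Quotient s) where
  Base := Quotient (C.baseSetoid s)
  finite_base := by
    have := C.finite_base
    infer_instance
  rel c := ⋃ b ∈ {b : C.Base | Quotient.mk (C.baseSetoid s) b = c}, C.image s b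
  nonempty_rel c := by
    induction c using Quotient.inductionOn with
    | h b =>
      obtain ⟨p, hp⟩ := C.nonempty_rel b
      exact ⟨_, Set.mem_biUnion (x := b) rfl (Set.mem_image_of_mem _ hp)⟩
  pairwise_disjoint c c' hne := by
    rw [Set.disjoint_left]
    intro p hp hp'
    simp only [Set.mem_iUnion, Set.mem_ofPred_eq, exists_prop] at hp hp'
    obtain ⟨b, rfl, hb⟩ := hp
    obtain ⟨b', rfl, hb'⟩ := hp'
    exact hne (Quotient.sound (Relation.EqvGen.rel _ _ ⟨p, hb, hb'⟩))
  exhaustive x y := by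
    induction x using Quotient.inductionOn with
    | h x =>
      induction y using Quotient.inductionOn with
      | h y =>
        obtain ⟨b, hb⟩ := C.exhaustive x y
        exact ⟨Quotient.mk _ b, Set.mem_biUnion (x := b) rfl ⟨(x, y), hb, rfl⟩⟩

/-- The composition table induced on the quotient by the table of `C`: the classes of all entries
of `b₁ ; b₂`, where `b₁` and `b₂` run through the two given classes. -/
def quotientComp (C : QualCalculus U) (s : Setoid U) (c₁ c₂ : (C.quotient s).Base) :
    Set (C.quotient s).Base :=
  {c | ∃ b₁ b₂ b : C.Base, Quotient.mk (C.baseSetoid s) b₁ = c₁ ∧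
    Quotient.mk (C.baseSetoid s) b₂ = c₂ ∧ b ∈ C.weakComp b₁ b₂ ∧
    Quotient.mk (C.baseSetoid s) b = c}

end QualCalculus

/-! ### Dipoles and their relations -/

/-- A dipole in the plane: an ordered pair of distinct points. -/
structure Dipole where
  /-- start point -/
  st : ℝ × ℝ
  /-- end point -/
  ed : ℝ × ℝ
  ne : st ≠ ed

/-- The vector from the start point to the end point of a dipole. -/
def Dipole.dir (d : Dipole) : ℝ × ℝ := d.ed - d.st

theorem Dipole.dir_ne_zero (d : Dipole) : d.dir ≠ 0 := sub_ne_zero.2 d.ne.symm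

/-- The determinant of two plane vectors; it is positive iff the mathematically oriented angle
from `v` to `w` lies strictly between `0` and `π`. -/
def cross (v w : ℝ × ℝ) : ℝ := v.1 * w.2 - v.2 * w.1

/-- Vectors of zero determinant are proportional. -/
theorem exists_smul_of_cross_eq_zero {v w : ℝ × ℝ} (hv : v ≠ 0) (h : cross v w = 0) :
    ∃ t : ℝ, w = t • v := by
  obtain ⟨a, b⟩ := v
  obtain ⟨c, d⟩ := w
  simp only [cross] at h
  by_cases ha : a = 0
  · have hb : b ≠ 0 := fun hb => hv (by rw [ha, hb]; rfl)
    refine ⟨d / b, ?_⟩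
    have hc : c = 0 := by
      subst ha
      have : b * c = 0 := by linarith
      exact (mul_eq_zero.1 this).resolve_left hb
    ext
    · simp [ha, hc]
    · simp [hb]
  · refine ⟨c / a, ?_⟩
    ext
    · simp [ha]
    · simp only [Prod.smul_mk, smul_eq_mul]
      field_simp
      linarith

theorem cross_smul_self (v : ℝ × ℝ) (t : ℝ) : cross v (t • v) = 0 := by
  simp only [cross, Prod.smul_fst, Prod.smul_snd, smul_eq_mul]
  ring

/-- The seven dipole-point relations: left, right, straight behind, at the start point, inside,
at the end point, straight in front. -/
inductive LR
  | l | r | b | s | i | e | f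

instance : Finite LR :=
  Finite.of_surjective (fun n : Fin 7 => match n with
    | 0 => LR.l | 1 => LR.r | 2 => LR.b | 3 => LR.s | 4 => LR.i | 5 => LR.e | 6 => LR.f) (by
    rintro (_ | _ | _ | _ | _ | _ | _)
    exacts [⟨0, rfl⟩, ⟨1, rfl⟩, ⟨2, rfl⟩, ⟨3, rfl⟩, ⟨4, rfl⟩, ⟨5, rfl⟩, ⟨6, rfl⟩])

/-- The dipole-point relation `d R p`. -/
def LR.Holds (d : Dipole) (p : ℝ × ℝ) : LR → Prop
  | .l => 0 < cross d.dir (p - d.st)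
  | .r => cross d.dir (p - d.st) < 0
  | .b => ∃ t : ℝ, t < 0 ∧ p = d.st + t • d.dir
  | .s => p = d.st
  | .i => ∃ t : ℝ, 0 < t ∧ t < 1 ∧ p = d.st + t • d.dir
  | .e => p = d.ed
  | .f => ∃ t : ℝ, 1 < t ∧ p = d.st + t • d.dir

/-- The four values of the angle between two dipoles: positive, negative, parallel,
anti-parallel. -/
inductive Turn
  | pos | neg | P | A

instance : Finite Turn :=
  Finite.of_surjective (fun n : Fin 4 => match n with
    | 0 => Turn.pos | 1 => Turn.neg | 2 => Turn.P | 3 => Turn.A) (by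
    rintro (_ | _ | _ | _)
    exacts [⟨0, rfl⟩, ⟨1, rfl⟩, ⟨2, rfl⟩, ⟨3, rfl⟩])

/-- The angle feature of a pair of dipoles. -/
def Turn.Holds (d d' : Dipole) : Turn → Prop
  | .pos => 0 < cross d.dir d'.dir
  | .neg => cross d.dir d'.dir < 0
  | .P => ∃ t : ℝ, 0 < t ∧ d'.dir = t • d.dir
  | .A => ∃ t : ℝ, t < 0 ∧ d'.dir = t • d.dir

/-- A five-letter symbol `R₁ R₂ R₃ R₄ R₅`. -/
@[ext]
structure Symbol5 where
  r₁ : LR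
  r₂ : LR
  r₃ : LR
  r₄ : LR
  r₅ : Turn

instance : Finite Symbol5 :=
  Finite.of_injective (fun R : Symbol5 => (R.r₁, R.r₂, R.r₃, R.r₄, R.r₅)) (by
    rintro ⟨⟩ ⟨⟩ h
    simpa using h)

/-- `A R B` iff `A R₁ s_B`, `A R₂ e_B`, `B R₃ s_A`, `B R₄ e_A` and the angle from `A` to `B`
is of kind `R₅`. -/
def Symbol5.Holds (R : Symbol5) (A B : Dipole) : Prop :=
  R.r₁.Holds A B.st ∧ R.r₂.Holds A B.ed ∧ R.r₃.Holds B A.st ∧ R.r₄.Holds B A.ed ∧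
    R.r₅.Holds A B

/-- The dipole `d` relates to the point `d.st + t • d.dir` according to `t`. -/
theorem LR.holds_line (d : Dipole) (t : ℝ) (R : LR) :
    R.Holds d (d.st + t • d.dir) ↔
      match R with
      | .l => False | .r => False | .b => t < 0 | .s => t = 0
      | .i => 0 < t ∧ t < 1 | .e => t = 1 | .f => 1 < t := by
  have hd := d.dir_ne_zero
  have key : ∀ u : ℝ, d.st + t • d.dir = d.st + u • d.dir ↔ t = u := fun u => by
    rw [add_right_inj]
    exact (smul_left_injective ℝ hd).eq_iff
  have h0 : d.st = d.st + (0 : ℝ) • d.dir := by simp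
  have h1 : d.ed = d.st + (1 : ℝ) • d.dir := by simp [Dipole.dir]
  cases R
  · simp [LR.Holds, cross_smul_self]
  · simp [LR.Holds, cross_smul_self]
  · simp [LR.Holds, key]
  · simp only [LR.Holds]
    conv_lhs => rhs; rw [h0]
    exact key 0
  · simp only [LR.Holds, key]
    constructor
    · rintro ⟨u, h, h', rfl⟩
      exact ⟨h, h'⟩
    · rintro ⟨h, h'⟩
      exact ⟨t, h, h', rfl⟩
  · simp only [LR.Holds]
    rw [h1]
    exact key 1
  · simp [LR.Holds, key]

/-- Every point is in exactly one of the seven relations to a given dipole. -/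
theorem LR.existsUnique (d : Dipole) (p : ℝ × ℝ) : ∃! R : LR, R.Holds d p := by
  by_cases h : cross d.dir (p - d.st) = 0
  · obtain ⟨t, ht⟩ := exists_smul_of_cross_eq_zero d.dir_ne_zero h
    obtain rfl : p = d.st + t • d.dir := by rw [← ht]; abel
    simp only [LR.holds_line]
    rcases lt_trichotomy t 0 with h | h | h
    · refine ⟨.b, h, fun R hR => ?_⟩
      cases R <;> grind
    · refine ⟨.s, h, fun R hR => ?_⟩
      cases R <;> grind
    · rcases lt_trichotomy t 1 with h' | h' | h'
      · refine ⟨.i, ⟨h, h'⟩, fun R hR => ?_⟩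
        cases R <;> grind
      · refine ⟨.e, h', fun R hR => ?_⟩
        cases R <;> grind
      · refine ⟨.f, h', fun R hR => ?_⟩
        cases R <;> grind
  · have hline : ∀ R : LR, R.Holds d p → R = .l ∨ R = .r := by
      intro R hR
      have h0 : ∀ t : ℝ, p ≠ d.st + t • d.dir := by
        rintro t rfl
        exact h (by rw [add_sub_cancel_left, cross_smul_self])
      cases R
      · exact .inl rfl
      · exact .inr rfl
      · obtain ⟨t, -, ht⟩ := hR
        exact absurd ht (h0 t)
      · exact absurd (show p = _ by simpa [LR.Holds] using hR) (h0 0)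
      · obtain ⟨t, -, -, ht⟩ := hR
        exact absurd ht (h0 t)
      · exact absurd (show p = _ by simpa [LR.Holds, Dipole.dir] using hR) (h0 1)
      · obtain ⟨t, -, ht⟩ := hR
        exact absurd ht (h0 t)
    rcases lt_or_gt_of_ne h with h | h
    · refine ⟨.r, h, fun R hR => (hline R hR).resolve_left ?_⟩
      rintro rfl
      exact lt_asymm h hR
    · refine ⟨.l, h, fun R hR => (hline R hR).resolve_right ?_⟩
      rintro rfl
      exact lt_asymm h hR

/-- Every pair of dipoles has exactly one of the four angle features. -/
theorem Turn.existsUnique (A B : Dipole) : ∃! R : Turn, R.Holds A B := by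
  by_cases h : cross A.dir B.dir = 0
  · obtain ⟨t, ht⟩ := exists_smul_of_cross_eq_zero A.dir_ne_zero h
    have key : ∀ u : ℝ, B.dir = u • A.dir → u = t := fun u hu =>
      smul_left_injective ℝ A.dir_ne_zero (hu.symm.trans ht)
    have ht0 : t ≠ 0 := by
      rintro rfl
      exact B.dir_ne_zero (by rw [ht, zero_smul])
    rcases lt_or_gt_of_ne ht0 with h0 | h0
    · refine ⟨.A, ⟨t, h0, ht⟩, fun R hR => ?_⟩
      cases R
      · exact absurd h (ne_of_gt hR)
      · exact absurd h (ne_of_lt hR)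
      · obtain ⟨u, hu, hu'⟩ := hR
        have := key u hu'
        linarith
      · rfl
    · refine ⟨.P, ⟨t, h0, ht⟩, fun R hR => ?_⟩
      cases R
      · exact absurd h (ne_of_gt hR)
      · exact absurd h (ne_of_lt hR)
      · rfl
      · obtain ⟨u, hu, hu'⟩ := hR
        have := key u hu'
        linarith
  · have hpar : ∀ t : ℝ, B.dir ≠ t • A.dir := fun t ht => h (by rw [ht, cross_smul_self])
    rcases lt_or_gt_of_ne h with h | h
    · refine ⟨.neg, h, fun R hR => ?_⟩
      cases R
      · exact absurd h (lt_asymm hR)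
      · rfl
      · obtain ⟨t, -, ht⟩ := hR
        exact absurd ht (hpar t)
      · obtain ⟨t, -, ht⟩ := hR
        exact absurd ht (hpar t)
    · refine ⟨.pos, h, fun R hR => ?_⟩
      cases R
      · rfl
      · exact absurd h (lt_asymm hR)
      · obtain ⟨t, -, ht⟩ := hR
        exact absurd ht (hpar t)
      · obtain ⟨t, -, ht⟩ := hR
        exact absurd ht (hpar t)

/-- The fine-grained dipole calculus with parallelism. Its base relations are the five-letter
symbols that are realized by some pair of dipoles. (For most of them the fifth letter is
determined by the first four, and is then usually not written.) -/
def DRAfp : QualCalculus Dipole where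
  Base := {R : Symbol5 // ∃ A B : Dipole, R.Holds A B}
  finite_base := inferInstance
  rel R := {p | R.1.Holds p.1 p.2}
  nonempty_rel R := by
    obtain ⟨A, B, h⟩ := R.2
    exact ⟨(A, B), h⟩
  pairwise_disjoint R R' hne := by
    rw [Set.disjoint_left]
    rintro ⟨A, B⟩ ⟨h₁, h₂, h₃, h₄, h₅⟩ ⟨k₁, k₂, k₃, k₄, k₅⟩
    refine hne (Subtype.ext (Symbol5.ext ?_ ?_ ?_ ?_ ?_))
    · exact (LR.existsUnique A B.st).unique h₁ k₁
    · exact (LR.existsUnique A B.ed).unique h₂ k₂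
    · exact (LR.existsUnique B A.st).unique h₃ k₃
    · exact (LR.existsUnique B A.ed).unique h₄ k₄
    · exact (Turn.existsUnique A B).unique h₅ k₅
  exhaustive A B := by
    obtain ⟨r₁, h₁, -⟩ := LR.existsUnique A B.st
    obtain ⟨r₂, h₂, -⟩ := LR.existsUnique A B.ed
    obtain ⟨r₃, h₃, -⟩ := LR.existsUnique B A.st
    obtain ⟨r₄, h₄, -⟩ := LR.existsUnique B A.ed
    obtain ⟨r₅, h₅, -⟩ := Turn.existsUnique A B
    exact ⟨⟨⟨r₁, r₂, r₃, r₄, r₅⟩, A, B, h₁, h₂, h₃, h₄, h₅⟩, h₁, h₂, h₃, h₄, h₅⟩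

/-! ### Oriented points -/

/-- Two dipoles are equivalent if they have the same start point and point in the same
direction. -/
def dirSetoid : Setoid Dipole where
  r d d' := d.st = d'.st ∧ SameRay ℝ d.dir d'.dir
  iseqv :=
    { refl := fun _ => ⟨rfl, SameRay.refl _⟩
      symm := fun h => ⟨h.1.symm, h.2.symm⟩
      trans := fun {_ y _} h k =>
        ⟨h.1.trans k.1, h.2.trans k.2 fun h0 => absurd h0 y.dir_ne_zero⟩ }

/-- The domain of oriented points. -/
abbrev OrientedPoint : Type := Quotient dirSetoid

/-- The calculus of oriented points with parallelism: the quotient of `DRAfp` by the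
identification of dipoles with the same start point and direction. -/
def DRAopp : QualCalculus OrientedPoint := DRAfp.quotient dirSetoid

end DipoleCalculus

/-! The equality of tables is formal and holds for every quotient: the interpretations of distinct
classes are disjoint, so the class relating two oriented points can be read off from any
representatives (`mk_mem_quotient_rel`), and witnesses for a composition pass up and down along the
projection.

Strength rests on symmetry. Orientation preserving affine maps preserve every relation of `DRAfp`
(`Symbol5.Holds.map`). If such a map carries one pair in a relation of the quotient to any other, up
to `dirSetoid`, it carries the middle point of a composition along with it, so a witness for one
pair yields one for all (`quotient_isStrong`).

This transitivity has two ingredients. The position of each start point relative to the other's ray,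
together with the turn, is constant on each class (`coarsen_eq_of_baseSetoid`). These data determine
the two directions `u`, `v` and the displacement `w` of the start points up to a linear map of
positive determinant and positive rescaling of `u` and `v` (`exists_map_of_position_eq`). -/

namespace DipoleCalculus

/-! ### Composition in quotients of arbitrary calculi -/

namespace QualCalculus

variable {U : Type}

/-- Membership of a pair of classes in a relation of the quotient can be tested on arbitrary
representatives. -/
theorem mk_mem_quotient_rel (C : QualCalculus U) (s : Setoid U) (c : (C.quotient s).Base)
    (x y : U) :
    (Quotient.mk s x, Quotient.mk s y) ∈ (C.quotient s).rel c ↔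
      ∃ b, (x, y) ∈ C.rel b ∧ Quotient.mk (C.baseSetoid s) b = c := by
  constructor
  · intro h
    obtain ⟨b, hb⟩ := C.exhaustive x y
    refine ⟨b, hb, ?_⟩
    -- The pair lies in the interpretations of both classes, and distinct classes are disjoint.
    by_contra hne
    refine Set.disjoint_left.1 ((C.quotient s).pairwise_disjoint _ _ hne) ?_ h
    exact Set.mem_biUnion (x := b) rfl ⟨(x, y), hb, rfl⟩
  · rintro ⟨b, hb, rfl⟩
    exact Set.mem_biUnion (x := b) rfl ⟨(x, y), hb, rfl⟩

/-- The composition table of a quotient is always the induced one. -/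
theorem quotientComp_eq_weakComp (C : QualCalculus U) (s : Setoid U)
    (c₁ c₂ : (C.quotient s).Base) :
    C.quotientComp s c₁ c₂ = (C.quotient s).weakComp c₁ c₂ := by
  ext c
  constructor
  · rintro ⟨b₁, b₂, b, h₁, h₂, ⟨⟨x, z⟩, ⟨y, hxy, hyz⟩, hxz⟩, h⟩
    exact ⟨(Quotient.mk s x, Quotient.mk s z),
      ⟨Quotient.mk s y, (C.mk_mem_quotient_rel s _ _ _).2 ⟨b₁, hxy, h₁⟩,
        (C.mk_mem_quotient_rel s _ _ _).2 ⟨b₂, hyz, h₂⟩⟩,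
      (C.mk_mem_quotient_rel s _ _ _).2 ⟨b, hxz, h⟩⟩
  · rintro ⟨⟨x, z⟩, ⟨y, hxy, hyz⟩, hxz⟩
    induction x using Quotient.inductionOn with | h x => ?_
    induction y using Quotient.inductionOn with | h y => ?_
    induction z using Quotient.inductionOn with | h z => ?_
    obtain ⟨b₁, h₁, e₁⟩ := (C.mk_mem_quotient_rel s _ _ _).1 hxy
    obtain ⟨b₂, h₂, e₂⟩ := (C.mk_mem_quotient_rel s _ _ _).1 hyz
    obtain ⟨b, h, e⟩ := (C.mk_mem_quotient_rel s _ _ _).1 hxz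
    exact ⟨b₁, b₂, b, e₁, e₂, ⟨(x, z), ⟨y, h₁, h₂⟩, h⟩, e⟩

/-- A quotient has strong composition if any two pairs of points in relations of the same class
are, up to the identification, related by a transformation preserving all base relations. -/
theorem quotient_isStrong (C : QualCalculus U) (s : Setoid U)
    (H : ∀ b b' : C.Base, C.baseSetoid s b b' → ∀ x z x' z' : U, (x, z) ∈ C.rel b →
      (x', z') ∈ C.rel b' → ∃ g : U → U, (∀ a y y', (y, y') ∈ C.rel a → (g y, g y') ∈ C.rel a) ∧
        s (g x) x' ∧ s (g z) z') :
    (C.quotient s).IsStrong := by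
  intro c₁ c₂
  ext ⟨x', z'⟩
  constructor
  · intro h
    obtain ⟨c, ⟨⟨x, z⟩, ⟨y, hxy, hyz⟩, hxz⟩, h'⟩ := Set.mem_iUnion₂.1 h
    induction x using Quotient.inductionOn with | h x => ?_
    induction y using Quotient.inductionOn with | h y => ?_
    induction z using Quotient.inductionOn with | h z => ?_
    induction x' using Quotient.inductionOn with | h x' => ?_
    induction z' using Quotient.inductionOn with | h z' => ?_
    obtain ⟨b₁, h₁, e₁⟩ := (C.mk_mem_quotient_rel s _ _ _).1 hxy
    obtain ⟨b₂, h₂, e₂⟩ := (C.mk_mem_quotient_rel s _ _ _).1 hyz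
    obtain ⟨b, hb, e⟩ := (C.mk_mem_quotient_rel s _ _ _).1 hxz
    obtain ⟨b', hb', e'⟩ := (C.mk_mem_quotient_rel s _ _ _).1 h'
    -- The map `g` carries the known composition through `y` to one through `g y`.
    obtain ⟨g, hg, hx, hz⟩ := H b b' (Quotient.exact (e.trans e'.symm)) x z x' z' hb hb'
    rw [← Quotient.sound hx, ← Quotient.sound hz]
    exact ⟨Quotient.mk s (g y), (C.mk_mem_quotient_rel s _ _ _).2 ⟨b₁, hg _ _ _ h₁, e₁⟩,
      (C.mk_mem_quotient_rel s _ _ _).2 ⟨b₂, hg _ _ _ h₂, e₂⟩⟩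
  -- This inclusion holds in every calculus, because base relations are exhaustive.
  · intro h
    obtain ⟨c, hc⟩ := (C.quotient s).exhaustive x' z'
    exact Set.mem_iUnion₂.2 ⟨c, ⟨_, h, hc⟩, hc⟩

end QualCalculus

/-! ### The action of orientation preserving affine maps on dipoles -/

theorem exists_cross_pos {v : ℝ × ℝ} (hv : v ≠ 0) : ∃ w, 0 < cross v w := by
  -- The quarter turn of `v`, for which the determinant is the squared length of `v`.
  refine ⟨(-v.2, v.1), ?_⟩
  have : v.1 ≠ 0 ∨ v.2 ≠ 0 := by
    by_contra! h
    exact hv (Prod.ext h.1 h.2)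
  simp only [cross]
  rcases this with h | h
  · nlinarith [sq_pos_of_ne_zero h, sq_nonneg v.2]
  · nlinarith [sq_pos_of_ne_zero h, sq_nonneg v.1]

/-- Cramer's rule in the plane. -/
theorem cross_smul_eq (u x z : ℝ × ℝ) :
    cross u x • z = cross z x • u + cross u z • x := by
  ext <;> simp only [cross, Prod.smul_fst, Prod.smul_snd, Prod.fst_add, Prod.snd_add,
    smul_eq_mul] <;> ring

/-- The linear map `L` multiplies oriented areas by a positive factor. -/
def PreservesOrientation (L : (ℝ × ℝ) →ₗ[ℝ] ℝ × ℝ) : Prop :=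
  ∃ k : ℝ, 0 < k ∧ ∀ v w, cross (L v) (L w) = k * cross v w

/-- The determinant pairing is nondegenerate, so scaling it by a nonzero factor forces a trivial
kernel. -/
theorem PreservesOrientation.map_ne_zero {L : (ℝ × ℝ) →ₗ[ℝ] ℝ × ℝ}
    (hL : PreservesOrientation L) {v : ℝ × ℝ} (hv : v ≠ 0) : L v ≠ 0 := by
  intro h
  obtain ⟨k, hk, H⟩ := hL
  obtain ⟨w, hw⟩ := exists_cross_pos hv
  have := H v w
  rw [h, show cross 0 (L w) = 0 by simp [cross]] at this
  exact (mul_pos hk hw).ne this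

/-- Two bases of the plane with the same orientation are related by an orientation preserving
linear map. -/
theorem exists_preservesOrientation {u x u' x' : ℝ × ℝ} (h : 0 < cross u' x' / cross u x) :
    ∃ L, PreservesOrientation L ∧ L u = u' ∧ L x = x' := by
  have h0 : cross u x ≠ 0 := by
    intro h0
    simp [h0] at h
  -- By Cramer's rule these coefficients are the coordinates of `z` in the basis `u`, `x`; the area
  -- factor is the quotient in `h`.
  refine ⟨{ toFun z := (cross z x / cross u x) • u' + (cross u z / cross u x) • x'
            map_add' y z := ?_
            map_smul' t z := ?_ }, ⟨_, h, fun v w => ?_⟩, ?_, ?_⟩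
  · ext <;> simp [cross] <;> ring
  · ext <;> simp [cross] <;> ring
  · simp only [LinearMap.coe_mk, AddHom.coe_mk]
    have key : cross v x * cross u w - cross u v * cross w x = cross u x * cross v w := by
      simp only [cross]
      ring
    have : cross v w = (cross v x * cross u w - cross u v * cross w x) / cross u x := by
      rw [key]
      field_simp
    rw [this]
    generalize cross v x = a, cross u w = b, cross u v = c, cross w x = d, cross u x = e at *
    simp only [cross, Prod.smul_fst, Prod.smul_snd, Prod.fst_add, Prod.snd_add, smul_eq_mul]
    field_simp
    ring
  · have : cross u u = 0 := by simp [cross, mul_comm]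
    simp [this, h0]
  · have : cross x x = 0 := by simp [cross, mul_comm]
    simp [this, h0]

/-- The image of a dipole under the affine map `z ↦ L z + a`. -/
def Dipole.map (L : (ℝ × ℝ) →ₗ[ℝ] ℝ × ℝ) (hL : PreservesOrientation L) (a : ℝ × ℝ)
    (d : Dipole) : Dipole where
  st := L d.st + a
  ed := L d.ed + a
  ne h := hL.map_ne_zero d.dir_ne_zero (by
    rw [Dipole.dir, map_sub, sub_eq_zero]
    exact (add_right_cancel h).symm)

theorem Dipole.map_dir (L : (ℝ × ℝ) →ₗ[ℝ] ℝ × ℝ) (hL : PreservesOrientation L) (a : ℝ × ℝ)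
    (d : Dipole) : (d.map L hL a).dir = L d.dir := by
  simp [Dipole.map, Dipole.dir]

theorem LR.Holds.map {d : Dipole} {p : ℝ × ℝ} {R : LR} (h : R.Holds d p)
    {L : (ℝ × ℝ) →ₗ[ℝ] ℝ × ℝ} (hL : PreservesOrientation L) (a : ℝ × ℝ) :
    R.Holds (d.map L hL a) (L p + a) := by
  have hst : (d.map L hL a).st = L d.st + a := rfl
  have hed : (d.map L hL a).ed = L d.ed + a := rfl
  have hsub : L p + a - (L d.st + a) = L (p - d.st) := by simp
  obtain ⟨k, hk, H⟩ := id hL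
  cases R <;> simp only [LR.Holds, Dipole.map_dir, hst, hed, hsub, H] at h ⊢
  · exact mul_pos hk h
  · exact mul_neg_of_pos_of_neg hk h
  · obtain ⟨t, ht, rfl⟩ := h
    exact ⟨t, ht, by rw [map_add, map_smul]; abel⟩
  · rw [h]
  · obtain ⟨t, ht, ht', rfl⟩ := h
    exact ⟨t, ht, ht', by rw [map_add, map_smul]; abel⟩
  · rw [h]
  · obtain ⟨t, ht, rfl⟩ := h
    exact ⟨t, ht, by rw [map_add, map_smul]; abel⟩

theorem Turn.Holds.map {A B : Dipole} {R : Turn} (h : R.Holds A B)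
    {L : (ℝ × ℝ) →ₗ[ℝ] ℝ × ℝ} (hL : PreservesOrientation L) (a : ℝ × ℝ) :
    R.Holds (A.map L hL a) (B.map L hL a) := by
  obtain ⟨k, hk, H⟩ := id hL
  cases R <;> simp only [Turn.Holds, Dipole.map_dir, H] at h ⊢
  · exact mul_pos hk h
  · exact mul_neg_of_pos_of_neg hk h
  · obtain ⟨t, ht, h⟩ := h
    exact ⟨t, ht, by rw [h, map_smul]⟩
  · obtain ⟨t, ht, h⟩ := h
    exact ⟨t, ht, by rw [h, map_smul]⟩

theorem Symbol5.Holds.map {A B : Dipole} {R : Symbol5} (h : R.Holds A B)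
    {L : (ℝ × ℝ) →ₗ[ℝ] ℝ × ℝ} (hL : PreservesOrientation L) (a : ℝ × ℝ) :
    R.Holds (A.map L hL a) (B.map L hL a) :=
  ⟨h.1.map hL a, h.2.1.map hL a, h.2.2.1.map hL a, h.2.2.2.1.map hL a, h.2.2.2.2.map hL a⟩

/-! ### The invariants of a pair of oriented points -/

/-- Forget the position of a point in front of the start point relative to the end point. -/
def LR.coarsen : LR → LR
  | .i => .f
  | .e => .f
  | R => R

/-- The position of the vector `w` relative to the ray spanned by `u`. -/
noncomputable def position (u w : ℝ × ℝ) : LR :=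
  if 0 < cross u w then .l else if cross u w < 0 then .r else
    -- The inner product matters only for collinear vectors; there, if `u ≠ 0`, its sign is that of
    -- the factor `t` in `w = t • u`, so the value does not depend on the metric.
    if u.1 * w.1 + u.2 * w.2 < 0 then .b else if u.1 * w.1 + u.2 * w.2 = 0 then .s else .f

theorem mul_neg_iff_neg_of_pos {a b : ℝ} (ha : 0 < a) : a * b < 0 ↔ b < 0 := by
  simpa using mul_lt_mul_iff_right₀ (b := b) (c := 0) ha

theorem position_smul_left {c : ℝ} (hc : 0 < c) (u w : ℝ × ℝ) :
    position (c • u) w = position u w := by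
  have h₁ : cross (c • u) w = c * cross u w := by
    simp only [cross, Prod.smul_fst, Prod.smul_snd, smul_eq_mul]
    ring
  have h₂ : (c • u).1 * w.1 + (c • u).2 * w.2 = c * (u.1 * w.1 + u.2 * w.2) := by
    simp only [Prod.smul_fst, Prod.smul_snd, smul_eq_mul]
    ring
  simp only [position, h₁, h₂, mul_pos_iff_of_pos_left hc, mul_neg_iff_neg_of_pos hc,
    mul_eq_zero, hc.ne', false_or]

theorem position_smul_self {u : ℝ × ℝ} (hu : u ≠ 0) (t : ℝ) :
    position u (t • u) = if t < 0 then .b else if t = 0 then .s else .f := by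
  have hpos : 0 < u.1 * u.1 + u.2 * u.2 := by
    have : u.1 ≠ 0 ∨ u.2 ≠ 0 := by
      by_contra! h
      exact hu (Prod.ext h.1 h.2)
    rcases this with h | h
    · nlinarith [sq_pos_of_ne_zero h, sq_nonneg u.2]
    · nlinarith [sq_pos_of_ne_zero h, sq_nonneg u.1]
  have h₂ : u.1 * (t • u).1 + u.2 * (t • u).2 = (u.1 * u.1 + u.2 * u.2) * t := by
    simp only [Prod.smul_fst, Prod.smul_snd, smul_eq_mul]
    ring
  simp only [position, cross_smul_self, h₂, lt_irrefl, if_false, mul_neg_iff_neg_of_pos hpos,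
    mul_eq_zero, hpos.ne', false_or]

/-- Merging `i`, `e` and `f` discards exactly the dependence on the length of the dipole. -/
theorem LR.Holds.coarsen_eq {d : Dipole} {p : ℝ × ℝ} {R : LR} (h : R.Holds d p) :
    R.coarsen = position d.dir (p - d.st) := by
  by_cases hc : cross d.dir (p - d.st) = 0
  · obtain ⟨t, ht⟩ := exists_smul_of_cross_eq_zero d.dir_ne_zero hc
    obtain rfl : p = d.st + t • d.dir := by rw [← ht]; abel
    rw [LR.holds_line] at h
    rw [ht, position_smul_self d.dir_ne_zero]
    cases R <;> simp only [LR.coarsen] <;> grind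
  · rcases lt_or_gt_of_ne hc with hc | hc
    · rw [(LR.existsUnique d p).unique h (show LR.r.Holds d p from hc)]
      simp [position, LR.coarsen, hc, hc.not_gt]
    · rw [(LR.existsUnique d p).unique h (show LR.l.Holds d p from hc)]
      simp [position, LR.coarsen, hc]

theorem sign_cross_of_position_eq {u w u' w' : ℝ × ℝ} (h : position u w = position u' w') :
    SignType.sign (cross u w) = SignType.sign (cross u' w') := by
  simp only [position] at h
  rcases lt_trichotomy (cross u w) 0 with h₁ | h₁ | h₁ <;>
  rcases lt_trichotomy (cross u' w') 0 with h₂ | h₂ | h₂ <;>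
  simp only [h₁, h₂, sign_neg, sign_pos, sign_zero] <;> exfalso <;> grind

theorem sign_of_position_smul_eq {u u' : ℝ × ℝ} (hu : u ≠ 0) (hu' : u' ≠ 0) {t t' : ℝ}
    (h : position u (t • u) = position u' (t' • u')) :
    SignType.sign t = SignType.sign t' := by
  rw [position_smul_self hu, position_smul_self hu'] at h
  rcases lt_trichotomy t 0 with h₁ | h₁ | h₁ <;>
  rcases lt_trichotomy t' 0 with h₂ | h₂ | h₂ <;>
  simp only [h₁, h₂, sign_neg, sign_pos, sign_zero] <;> exfalso <;> grind

/-- The position of the second direction relative to the first one in a given turn. -/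
def Turn.position : Turn → LR
  | .pos => .l
  | .neg => .r
  | .P => .f
  | .A => .b

theorem Turn.Holds.eq_position {A B : Dipole} {R : Turn} (h : R.Holds A B) :
    R.position = DipoleCalculus.position A.dir B.dir := by
  cases R <;> simp only [Turn.Holds] at h <;> simp only [Turn.position]
  · simp [DipoleCalculus.position, h]
  · simp [DipoleCalculus.position, h, h.not_gt]
  · obtain ⟨t, ht, h⟩ := h
    simp [h, position_smul_self A.dir_ne_zero, ht.ne', ht.not_gt]
  · obtain ⟨t, ht, h⟩ := h
    simp [h, position_smul_self A.dir_ne_zero, ht]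

theorem Turn.Holds.congr {A B A' B' : Dipole} {R : Turn} (h : R.Holds A B)
    (hA : dirSetoid A A') (hB : dirSetoid B B') : R.Holds A' B' := by
  obtain ⟨a, ha, hA⟩ := hA.2.exists_pos_left A.dir_ne_zero A'.dir_ne_zero
  obtain ⟨b, hb, hB⟩ := hB.2.exists_pos_left B.dir_ne_zero B'.dir_ne_zero
  have hc : cross A'.dir B'.dir = a * b * cross A.dir B.dir := by
    simp only [← hA, ← hB, cross, Prod.smul_fst, Prod.smul_snd, smul_eq_mul]
    ring
  cases R <;> simp only [Turn.Holds, hc] at h ⊢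
  · positivity
  · exact mul_neg_of_pos_of_neg (mul_pos ha hb) h
  · obtain ⟨t, ht, h⟩ := h
    -- From `B'.dir = b • B.dir`, `B.dir = t • A.dir` and `A'.dir = a • A.dir`.
    refine ⟨b * t / a, by positivity, ?_⟩
    rw [← hA, ← hB, h, smul_smul, smul_smul]
    field_simp
  · obtain ⟨t, ht, h⟩ := h
    refine ⟨b * t / a, div_neg_of_neg_of_pos (mul_neg_of_pos_of_neg hb ht) ha, ?_⟩
    rw [← hA, ← hB, h, smul_smul, smul_smul]
    field_simp

theorem position_congr {A A' : Dipole} (h : dirSetoid A A') (w : ℝ × ℝ) :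
    position A.dir w = position A'.dir w := by
  obtain ⟨a, ha, hA⟩ := h.2.exists_pos_left A.dir_ne_zero A'.dir_ne_zero
  rw [← hA, position_smul_left ha]

/-- The part of a five-letter symbol that depends on the oriented points only. -/
def Symbol5.coarsen (R : Symbol5) : LR × LR × Turn := (R.r₁.coarsen, R.r₃.coarsen, R.r₅)

/-- Each generating identification comes from two equivalent pairs of dipoles, and the coarsened
symbol depends only on start points and directions; equality then extends to the generated
equivalence. -/
theorem coarsen_eq_of_baseSetoid {b b' : DRAfp.Base} (h : DRAfp.baseSetoid dirSetoid b b') :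
    b.1.coarsen = b'.1.coarsen := by
  induction h with
  | rel b b' h =>
    obtain ⟨-, ⟨⟨A, B⟩, h, rfl⟩, ⟨⟨A', B'⟩, h', e⟩⟩ := h
    obtain ⟨hA, hB⟩ := Prod.ext_iff.1 e
    replace hA : dirSetoid A' A := Quotient.exact hA
    replace hB : dirSetoid B' B := Quotient.exact hB
    obtain ⟨h₁, -, h₃, -, h₅⟩ := h
    obtain ⟨k₁, -, k₃, -, k₅⟩ := h'
    refine Prod.ext ?_ (Prod.ext ?_ ?_)
    · refine h₁.coarsen_eq.trans (Eq.trans ?_ k₁.coarsen_eq.symm)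
      rw [position_congr hA, hA.1, hB.1]
    · refine h₃.coarsen_eq.trans (Eq.trans ?_ k₃.coarsen_eq.symm)
      rw [position_congr hB, hA.1, hB.1]
    · exact (Turn.existsUnique A B).unique h₅ (k₅.congr hA hB)
  | refl => rfl
  | symm _ _ _ ih => exact ih.symm
  | trans _ _ _ _ _ ih ih' => exact ih.trans ih'

/-! ### Transitivity of the affine group on each relation of oriented points -/

theorem div_pos_of_sign_eq {a b : ℝ} (h : SignType.sign a = SignType.sign b) (ha : a ≠ 0) :
    0 < a / b := by
  rcases lt_or_gt_of_ne ha with ha | ha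
  · rw [sign_neg ha, eq_comm, sign_eq_neg_one_iff] at h
    exact div_pos_of_neg_of_neg ha h
  · rw [sign_pos ha, eq_comm, sign_eq_one_iff] at h
    exact div_pos ha h

theorem exists_pos_mul_eq_of_sign_eq {a b : ℝ} (h : SignType.sign a = SignType.sign b) :
    ∃ c : ℝ, 0 < c ∧ c * a = b := by
  by_cases ha : a = 0
  · subst ha
    rw [sign_zero, eq_comm, sign_eq_zero_iff] at h
    exact ⟨1, one_pos, by simp [h]⟩
  · refine ⟨b / a, ?_, div_mul_cancel₀ _ ha⟩
    simpa using inv_pos.2 (div_pos_of_sign_eq h ha)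

theorem sign_div_eq {a b a' b' : ℝ} (h : SignType.sign a = SignType.sign a')
    (k : SignType.sign b = SignType.sign b') : SignType.sign (a / b) = SignType.sign (a' / b') := by
  obtain ⟨c, hc, rfl⟩ := exists_pos_mul_eq_of_sign_eq h
  obtain ⟨d, hd, rfl⟩ := exists_pos_mul_eq_of_sign_eq k
  rw [mul_div_mul_comm, sign_mul, sign_pos (div_pos hc hd), one_mul]

/-- Configurations of three vectors with the same relative positions are related by an
orientation preserving linear map, up to positive rescaling of the last two. -/
theorem exists_map_of_position_eq {u v w u' v' w' : ℝ × ℝ} (hu : u ≠ 0) (hu' : u' ≠ 0)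
    (huw : position u w = position u' w')
    (hvw : SignType.sign (cross v w) = SignType.sign (cross v' w'))
    (huv : position u v = position u' v') :
    ∃ L, PreservesOrientation L ∧ L w = w' ∧ (∃ α : ℝ, 0 < α ∧ L u = α • u') ∧
      ∃ β : ℝ, 0 < β ∧ L v = β • v' := by
  have suw := sign_cross_of_position_eq huw
  have suv := sign_cross_of_position_eq huv
  -- If `u` and `w` are collinear, `L w = w'` only fixes how `L` scales `u`, and `v` can be treated
  -- separately. Otherwise `u`, `w` is a basis and `L` is determined by the scaling of `u`.
  by_cases h : cross u w = 0
  · have h' : cross u' w' = 0 := by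
      rwa [h, sign_zero, eq_comm, sign_eq_zero_iff] at suw
    obtain ⟨t, rfl⟩ := exists_smul_of_cross_eq_zero hu h
    obtain ⟨t', rfl⟩ := exists_smul_of_cross_eq_zero hu' h'
    obtain ⟨α, hα, hαt⟩ := exists_pos_mul_eq_of_sign_eq (sign_of_position_smul_eq hu hu' huw)
    by_cases k : cross u v = 0
    · have k' : cross u' v' = 0 := by
        rwa [k, sign_zero, eq_comm, sign_eq_zero_iff] at suv
      obtain ⟨r, rfl⟩ := exists_smul_of_cross_eq_zero hu k
      obtain ⟨r', rfl⟩ := exists_smul_of_cross_eq_zero hu' k'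
      obtain ⟨γ, hγ, hγr⟩ :=
        exists_pos_mul_eq_of_sign_eq (sign_of_position_smul_eq hu hu' huv).symm
      -- All three vectors lie on one line, so any positively oriented completion to a basis will
      -- do.
      obtain ⟨x, hx⟩ := exists_cross_pos hu
      obtain ⟨x', hx'⟩ := exists_cross_pos (smul_ne_zero hα.ne' hu')
      obtain ⟨L, hL, hLu, -⟩ := exists_preservesOrientation (div_pos hx' hx)
      refine ⟨L, hL, ?_, ⟨α, hα, hLu⟩, γ * α, by positivity, ?_⟩
      · rw [map_smul, hLu, smul_smul, mul_comm, hαt]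
      · rw [map_smul, hLu, smul_smul, smul_smul, ← hγr]
        congr 1
        ring
    · have key : 0 < cross (α • u') v' / cross u v := by
        have : cross (α • u') v' = α * cross u' v' := by
          simp only [cross, Prod.smul_fst, Prod.smul_snd, smul_eq_mul]
          ring
        rw [this, mul_div_assoc]
        refine mul_pos hα ?_
        simpa using inv_pos.2 (div_pos_of_sign_eq suv k)
      obtain ⟨L, hL, hLu, hLv⟩ := exists_preservesOrientation key
      refine ⟨L, hL, ?_, ⟨α, hα, hLu⟩, 1, one_pos, by rw [hLv, one_smul]⟩
      rw [map_smul, hLu, smul_smul, mul_comm, hαt]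
  · have h' : cross u' w' ≠ 0 := fun h' => h (by simpa [h'] using suw)
    have hv_eq : v = (cross v w / cross u w) • u + (cross u v / cross u w) • w := by
      rw [div_eq_inv_mul, div_eq_inv_mul, mul_smul, mul_smul, ← smul_add, ← cross_smul_eq,
        inv_smul_smul₀ h]
    have hv'_eq : v' = (cross v' w' / cross u' w') • u' + (cross u' v' / cross u' w') • w' := by
      rw [div_eq_inv_mul, div_eq_inv_mul, mul_smul, mul_smul, ← smul_add, ← cross_smul_eq,
        inv_smul_smul₀ h']
    have sa := sign_div_eq hvw suw
    have sb := sign_div_eq suv suw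
    generalize cross v w / cross u w = a at *
    generalize cross u v / cross u w = b at *
    generalize cross v' w' / cross u' w' = a' at *
    generalize cross u' v' / cross u' w' = b' at *
    -- Now `v = a • u + b • w`, and likewise for the primed vectors. With `β * b' = b`, `γ * a = a'`
    -- and `L u = (β * γ) • u'`, one gets `L v = β • (a' • u' + b' • w') = β • v'`.
    obtain ⟨β, hβ, hβb⟩ := exists_pos_mul_eq_of_sign_eq sb.symm
    obtain ⟨γ, hγ, hγa⟩ := exists_pos_mul_eq_of_sign_eq sa
    have key : 0 < cross ((β * γ) • u') w' / cross u w := by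
      have : cross ((β * γ) • u') w' = β * γ * cross u' w' := by
        simp only [cross, Prod.smul_fst, Prod.smul_snd, smul_eq_mul]
        ring
      rw [this, mul_div_assoc]
      refine mul_pos (mul_pos hβ hγ) ?_
      simpa using inv_pos.2 (div_pos_of_sign_eq suw h)
    obtain ⟨L, hL, hLu, hLw⟩ := exists_preservesOrientation key
    refine ⟨L, hL, hLw, ⟨_, mul_pos hβ hγ, hLu⟩, β, hβ, ?_⟩
    rw [hv_eq, hv'_eq, map_add, map_smul, map_smul, hLu, hLw, ← hγa, ← hβb, smul_add, smul_smul,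
      smul_smul, smul_smul]
    congr 2
    ring

theorem exists_map_of_coarsen_eq {R R' : Symbol5} (h : R.coarsen = R'.coarsen)
    {A B A' B' : Dipole} (hR : R.Holds A B) (hR' : R'.Holds A' B') :
    ∃ L, ∃ hL : PreservesOrientation L, ∃ a, dirSetoid (A.map L hL a) A' ∧
      dirSetoid (B.map L hL a) B' := by
  obtain ⟨h₁, -, h₃, -, h₅⟩ := hR
  obtain ⟨k₁, -, k₃, -, k₅⟩ := hR'
  simp only [Symbol5.coarsen, Prod.mk.injEq] at h
  obtain ⟨e₁, e₃, e₅⟩ := h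
  have huw := h₁.coarsen_eq.symm.trans (e₁.trans k₁.coarsen_eq)
  have hvw := sign_cross_of_position_eq (h₃.coarsen_eq.symm.trans (e₃.trans k₃.coarsen_eq))
  rw [e₅] at h₅
  have huv := h₅.eq_position.symm.trans k₅.eq_position
  -- The third letter sees the start of `A` from `B`, which gives the opposite of the displacement
  -- used in `huw`.
  have hneg : ∀ v p q : ℝ × ℝ, cross v (p - q) = -cross v (q - p) := fun v p q => by
    simp only [cross, Prod.fst_sub, Prod.snd_sub]
    ring
  rw [hneg, hneg B'.dir, Left.sign_neg, Left.sign_neg, neg_inj] at hvw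
  obtain ⟨L, hL, hw, ⟨α, hα, hu⟩, β, hβ, hv⟩ := exists_map_of_position_eq A.dir_ne_zero
    A'.dir_ne_zero huw hvw huv
  -- The translation sends `A.st` to `A'.st`; then `B.st` goes to `B'.st` because `L` matches the
  -- displacements.
  refine ⟨L, hL, A'.st - L A.st, ⟨?_, ?_⟩, ?_, ?_⟩
  · simp [Dipole.map]
  · rw [Dipole.map_dir, hu]
    exact SameRay.sameRay_pos_smul_left _ hα
  · have : L B.st - L A.st = B'.st - A'.st := by rw [← map_sub, hw]
    simp only [Dipole.map]
    rw [add_sub_left_comm, this]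
    abel
  · rw [Dipole.map_dir, hv]
    exact SameRay.sameRay_pos_smul_left _ hβ

end DipoleCalculus

theorem mainTheorem2 :
    (∀ c₁ c₂ : DipoleCalculus.DRAopp.Base,
      DipoleCalculus.DRAfp.quotientComp DipoleCalculus.dirSetoid c₁ c₂ =
        DipoleCalculus.DRAopp.weakComp c₁ c₂) ∧
    DipoleCalculus.DRAopp.IsStrong := by
  refine ⟨DipoleCalculus.DRAfp.quotientComp_eq_weakComp DipoleCalculus.dirSetoid,
    DipoleCalculus.DRAfp.quotient_isStrong _ fun b b' h A B A' B' hb hb' => ?_⟩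
  obtain ⟨L, hL, a, hA, hB⟩ := DipoleCalculus.exists_map_of_coarsen_eq
    (DipoleCalculus.coarsen_eq_of_baseSetoid h) hb hb'
  exact ⟨fun d => d.map L hL a, fun _ _ _ h => h.map hL a, hA, hB⟩
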